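/- **Setting.** Let $N$ be a connected, simply connected (finite-dimensional, real) Lie group whose Lie algebra $L$ is nilpotent, with lower central series $L=L_1\supseteq L_2\supseteq\dots$, $L_{k+1}=[L,L_k]$. Fix a grading of $L$, i.e. subspaces $R_k$ with $L=\bigoplus_{k\ge1}R_k$, $R_k\subset L_k$, $L_k=R_k\oplus L_{k+1}$ and $[R_i,R_j]\subset R_{i+j}$. In canonical coordinates $a=\exp(a_1+\dots+a_n)$, $a_k\in R_k$, on $N$ the dilations are $$a\mapsto a^r=\exp(ra_1+r^2a_2+\dots+r^na_n),\qquad r>0 .$$ Let $T$ be a (strongly continuous) unitary representation of $N$ in a nonzero complex Hilbert space $H$, and put $T_r(a)=T(a^r)$. The Gårding space $H^*\subset H$ consists of all $h\in H$ such that $a\mapsto\langle T(a)h,h'\rangle$ is $C^\infty$ on $N$ for every $h'\in H$. Let $u$ be a smooth positive function on $(0,\infty)$ such that the measure $dm(r)=e^{-u(r)/2}\,r^{-1}dr$ on $(0,\infty)$ is infinite and $m((\varepsilon,\infty))<\infty$ for all $\varepsilon>0$. A nonzero vector $h\in H$ is called *almost invariant* if $$\int_0^\infty\|T_r(a)h-h\|\,dm(r)<\infty\quad\text{for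 every }a\in N,$$ and $T$ is called *summable* (with respect to $m$) if $H$ contains no nonzero $T$-invariant vector and contains an almost invariant vector. **Theorem.** Suppose that $H$ contains no nonzero $T$-invariant vector. Then, for every $u$ as above: 1. every nonzero vector of the Gårding space $H^*$ is almost invariant; 2. hence $T$ is summable; 3. moreover, for every $h\in H^*$ with $\|h\|=1$ and every $a\in N$, $\langle T_r(a)h,h\rangle=1+O(r)$ as $r\to0^+$. -/

import Mathlib

open Set Filter Topology MeasureTheory
open scoped Manifold ContDiff

noncomputable section

/-! ### Graded nilpotent Lie algebras -/

/-- A grading of a Lie algebra `L` over `ℝ`: subspaces `R 1, R 2, …` with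
`L = ⨁_{k ≥ 1} R k`, `R k ⊆ L_k`, `L_k = R k ⊕ L_{k+1}` and `[R i, R j] ⊆ R (i + j)`, where
`L = L_1 ⊇ L_2 ⊇ …` is the lower central series. Mathlib numbers the lower central series
from `0`, so that `L_{k+1}` is `LieModule.lowerCentralSeries ℝ L L k`. The index `0` is unused
(`R 0 = 0`), and `R k = 0` for `k` larger than the class of a nilpotent `L`, as `R k ⊆ L_k`. -/
structure LieGrading (L : Type*) [LieRing L] [LieAlgebra ℝ L] where
  /-- The homogeneous components. -/
  R : ℕ → Submodule ℝ L
  zero_eq_bot : R 0 = ⊥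
  isInternal : DirectSum.IsInternal R
  le_lcs : ∀ k, R (k + 1) ≤ (LieModule.lowerCentralSeries ℝ L L k).toSubmodule
  disjoint_lcs : ∀ k,
    Disjoint (R (k + 1)) (LieModule.lowerCentralSeries ℝ L L (k + 1)).toSubmodule
  sup_lcs : ∀ k, R (k + 1) ⊔ (LieModule.lowerCentralSeries ℝ L L (k + 1)).toSubmodule =
    (LieModule.lowerCentralSeries ℝ L L k).toSubmodule
  lie_mem : ∀ i j, ∀ x ∈ R i, ∀ y ∈ R j, ⁅x, y⁆ ∈ R (i + j)

namespace LieGrading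

variable {L : Type*} [LieRing L] [LieAlgebra ℝ L]

theorem bijective_coe (𝒢 : LieGrading L) : Function.Bijective (DirectSum.coeLinearMap 𝒢.R) :=
  𝒢.isInternal

/-- The dilation of a graded Lie algebra,
`(a_1, …, a_n) ↦ (r a_1, r² a_2, …, rⁿ a_n)` for `a_k ∈ R k`. -/
def scale (𝒢 : LieGrading L) (r : ℝ) : L →ₗ[ℝ] L :=
  DirectSum.toModule ℝ ℕ L (fun k => (r ^ k) • (𝒢.R k).subtype) ∘ₗ
    (LinearEquiv.ofBijective (DirectSum.coeLinearMap 𝒢.R) 𝒢.bijective_coe).symm.toLinearMap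

theorem scale_of_mem (𝒢 : LieGrading L) (r : ℝ) {k : ℕ} {x : L} (hx : x ∈ 𝒢.R k) :
    𝒢.scale r x = r ^ k • x := by
  have h : (LinearEquiv.ofBijective (DirectSum.coeLinearMap 𝒢.R) 𝒢.bijective_coe).symm x =
      DirectSum.lof ℝ ℕ (fun i => 𝒢.R i) k ⟨x, hx⟩ := by
    rw [LinearEquiv.symm_apply_eq]
    simp
  simp [scale, h]

end LieGrading

/-! ### Lie groups: exponential map, dilations -/

/-- A smooth real Lie group is smooth enough for Mathlib's Lie algebra structure on its tangent
space at the identity. -/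
instance lieGroupMinSmoothness {d : ℕ} {N : Type*} [TopologicalSpace N]
    [ChartedSpace (EuclideanSpace ℝ (Fin d)) N] [Group N] [LieGroup (𝓡 d) ∞ N] :
    LieGroup (𝓡 d) (minSmoothness ℝ 3) N :=
  LieGroup.of_le (n := ∞) (by simpa using (mod_cast le_top : ((3 : ℕ∞) : WithTop ℕ∞) ≤ ∞))

section Dilation

variable {d : ℕ} {N : Type*} [TopologicalSpace N]
  [ChartedSpace (EuclideanSpace ℝ (Fin d)) N] [Group N] [LieGroup (𝓡 d) ∞ N]

/-- The exponential map `exp : L → N` of the Lie group `N` with Lie algebra `L`: `exp X = γ 1`,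
where `γ : ℝ → N` is the integral curve of the left-invariant vector field of `X` with `γ 0 = 1`
(such a `γ` exists and is unique; it is the one-parameter subgroup generated by `X`). -/
def lieExp (X : GroupLieAlgebra (𝓡 d) N) : N :=
  Classical.epsilon fun g : N => ∃ γ : ℝ → N,
    γ 0 = 1 ∧ IsMIntegralCurve γ (mulInvariantVectorField (I := 𝓡 d) X) ∧ γ 1 = g

/-- The inverse `log : N → L` of the exponential map, i.e. the canonical coordinates on `N`.
(For a connected, simply connected nilpotent Lie group `exp` is a diffeomorphism.) -/
def lieLog (a : N) : GroupLieAlgebra (𝓡 d) N :=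
  Function.invFun (lieExp (d := d) (N := N)) a

/-- The dilation `a ↦ a^r` of a graded Lie group: in canonical coordinates it is
`(a_1, …, a_n) ↦ (r a_1, r² a_2, …, rⁿ a_n)`. -/
def LieGrading.dilate (𝒢 : LieGrading (GroupLieAlgebra (𝓡 d) N)) (r : ℝ) (a : N) : N :=
  lieExp (𝒢.scale r (lieLog (d := d) a))

end Dilation

/-! ### Unitary representations -/

section Representations

variable {N : Type*} [Group N] {H : Type*} [NormedAddCommGroup H] [InnerProductSpace ℂ H]

/-- The conjugates `T_r(a) = T(a^r)` of a unitary representation `T`, for a given family of maps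
`δ r : a ↦ a^r`. -/
def conjRep (δ : ℝ → N → N) (T : N →* (H ≃ₗᵢ[ℂ] H)) (r : ℝ) (a : N) : H ≃ₗᵢ[ℂ] H :=
  T (δ r a)

/-- There is no nonzero vector of `H` invariant under all `T a`. -/
def HasNoInvariantVectors (T : N →* (H ≃ₗᵢ[ℂ] H)) : Prop :=
  ∀ h : H, (∀ a, T a h = h) → h = 0

/-- `h` is almost invariant: it is nonzero and `∫ ‖T_r(a) h - h‖ dm(r) < ∞` for every `a`. -/
def IsAlmostInvariant (δ : ℝ → N → N) (T : N →* (H ≃ₗᵢ[ℂ] H)) (m : Measure ℝ) (h : H) : Prop :=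
  h ≠ 0 ∧ ∀ a : N, Integrable (fun r => ‖conjRep δ T r a h - h‖) m

/-- `T` is summable with respect to `m`: there is no nonzero invariant vector, and there is a
(nonzero) almost invariant vector. -/
def IsSummable (δ : ℝ → N → N) (T : N →* (H ≃ₗᵢ[ℂ] H)) (m : Measure ℝ) : Prop :=
  HasNoInvariantVectors T ∧ ∃ h : H, IsAlmostInvariant δ T m h

/-- The Gårding space: all `h` such that `a ↦ ⟨T(a) h, h'⟩` is a `C^∞` function on the Lie group
for all `h'`. -/
def gardingSpace (d : ℕ) [TopologicalSpace N] [ChartedSpace (EuclideanSpace ℝ (Fin d)) N]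
    (T : N →* (H ≃ₗᵢ[ℂ] H)) : Submodule ℂ H where
  carrier := {h | ∀ h' : H, ContMDiff (𝓡 d) 𝓘(ℝ, ℂ) ∞ fun a : N => inner ℂ (T a h) h'}
  zero_mem' := fun h' => by simpa using contMDiff_const
  add_mem' := fun {x y} hx hy h' => by
    have h := (hx h').add (hy h')
    simp only [map_add, inner_add_left]
    exact h
  smul_mem' := fun c x hx h' => by
    have h := (((starRingEnd ℂ) c • ContinuousLinearMap.id ℝ ℂ).contMDiff (n := ∞)).comp (hx h')
    simp only [map_smul, inner_smul_left]
    exact h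

end Representations

/-- The measure `dm(r) = e^{-u(r)/2} r⁻¹ dr` on the half-line `(0, ∞)`. -/
def halfLineMeasure (u : ℝ → ℝ) : Measure ℝ :=
  (volume.restrict (Ioi 0)).withDensity fun r => ENNReal.ofReal (Real.exp (-(u r) / 2) * r⁻¹)

/-- The admissible `u`: smooth and positive on the half-line, such that
`dm(r) = e^{-u(r)/2} r⁻¹ dr` is an infinite measure with `m (ε, ∞) < ∞` for all `ε > 0`. -/
structure IsAdmissibleWeight (u : ℝ → ℝ) : Prop where
  smooth : ContDiffOn ℝ ∞ u (Ioi 0)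
  pos : ∀ r, 0 < r → 0 < u r
  tail_lt_top : ∀ ε, 0 < ε → halfLineMeasure u (Ioi ε) < ⊤
  infinite : halfLineMeasure u univ = ⊤

end

/-!
The dilations act on the Lie algebra by `a_1 + ... + a_n ↦ r a_1 + ... + r^n a_n`, so the point is a
Lipschitz estimate `‖T (exp Y) h - T (exp Z) h‖ ≤ C ‖Y - Z‖` for a Gårding vector `h`, with `C`
independent of `Z`. It comes from Duhamel's formula `hasDerivAt_oneParam_mul_oneParam`: along
`s ↦ exp ((1 - s) Z) exp (s Y)` a matrix coefficient `⟨T(·) h, h'⟩` changes at the rate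
`D ⟨T(·) T(b) h, T(a)⁻¹ h'⟩ (Y - Z)`, where `D` is the derivative at the identity,
`a = exp ((1 - s) Z)` and `b = exp (s Y)`. This derivative is linear in `Y - Z`, and by the uniform
boundedness principle it is a bounded functional of `h'`, uniformly for `b` in the compact set
`exp ([0, 1] Y)` (`exists_norm_derivOne_le`). The exponential map enters only through its
one-parameter subgroups, so its smoothness plays no role.

Applied to `Y = 0`, the estimate gives `‖T (a^r) h - h‖ = O(r)` as `r → 0`
(`exists_norm_map_lieExp_scale_sub_self_le`), which contains the statement on `⟨T_r(a) h, h⟩`.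
Applied to other points of a dilation orbit, it shows that `r ↦ T (a^r) h` is continuous, hence
measurable. Almost invariance follows: near `0` the bound `O(r)` compensates the factor `r⁻¹` of the density,
while the rest of the half-line has finite measure and the integrand is at most `2 ‖h‖`.

Summability needs in addition a nonzero Gårding vector. As usual it is `∫ φ(g) T(g) h dg` for a bump
function `φ` and a Haar measure (`exists_mem_gardingSpace_ne_zero`). Translating, it is enough to
prove smoothness of its matrix coefficients at the identity, and for a small support of `φ` this is
a statement on parametric integrals in a single chart (`contMDiffAt_one_integral_inv_mul`).
-/

noncomputable section

/-! ### One-parameter subgroups -/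

section OneParameter

variable {d : ℕ} {N : Type*} [TopologicalSpace N] [ChartedSpace (EuclideanSpace ℝ (Fin d)) N]
  [Group N]

theorem mulInvariantVectorField_one (X : GroupLieAlgebra (𝓡 d) N) :
    mulInvariantVectorField X (1 : N) = X := by
  have e : (fun x : N => 1 * x) = id := by ext x; simp
  simp only [mulInvariantVectorField]
  rw [e, mfderiv_id]
  rfl

/-- `γ` is the one-parameter subgroup generated by `X`, described as the integral curve through the
identity of the left-invariant vector field of `X`; see `IsOneParam.map_add` for the homomorphism
property. -/
structure IsOneParam (X : GroupLieAlgebra (𝓡 d) N) (γ : ℝ → N) : Prop where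
  zero : γ 0 = 1
  isMIntegralCurve : IsMIntegralCurve γ (mulInvariantVectorField (I := 𝓡 d) X)

theorem IsOneParam.mdifferentiable {X : GroupLieAlgebra (𝓡 d) N} {γ : ℝ → N} (h : IsOneParam X γ) :
    MDifferentiable 𝓘(ℝ, ℝ) (𝓡 d) γ :=
  fun t => (h.isMIntegralCurve t).mdifferentiableAt

/-- The derivative at the identity of a function on `N`, as a linear form on the Lie algebra;
it is `0` if the function is not differentiable there. -/
def derivOne (φ : N → ℂ) : GroupLieAlgebra (𝓡 d) N →ₗ[ℝ] ℂ :=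
  (mfderiv (𝓡 d) 𝓘(ℝ, ℂ) φ 1).toLinearMap

theorem IsOneParam.hasDerivAt_zero {Y : GroupLieAlgebra (𝓡 d) N} {γ : ℝ → N} (h : IsOneParam Y γ)
    {φ : N → ℂ} (hφ : MDifferentiable (𝓡 d) 𝓘(ℝ, ℂ) φ) :
    HasDerivAt (fun t => φ (γ t)) (derivOne φ Y) 0 := by
  have h1 := (hφ (γ 0)).hasMFDerivAt.comp 0 (h.isMIntegralCurve 0)
  rw [h.zero] at h1
  have h2 : HasFDerivAt (fun t => φ (γ t))
      (ContinuousLinearMap.smulRight (1 : ℝ →L[ℝ] ℝ) (derivOne φ Y)) 0 := by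
    refine h1.hasFDerivAt.congr_fderiv (ContinuousLinearMap.ext fun a => ?_)
    rw [mulInvariantVectorField_one]
    exact (derivOne φ).map_smul a Y
  simpa using h2.hasDerivAt

variable [LieGroup (𝓡 d) ∞ N]

theorem mdifferentiable_const_mul (g : N) : MDifferentiable (𝓡 d) (𝓡 d) (fun x : N => g * x) :=
  (contMDiff_mul_left (I := 𝓡 d) (n := ∞)).mdifferentiable (by simp)

theorem mfderiv_mul_left_mulInvariantVectorField (X : GroupLieAlgebra (𝓡 d) N) (g h : N) :
    mfderiv (𝓡 d) (𝓡 d) (fun x : N => g * x) h (mulInvariantVectorField X h) =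
      mulInvariantVectorField X (g * h) := by
  have e : (fun x : N => g * h * x) = (fun x => g * x) ∘ (fun x => h * x) := by
    ext x; simp [mul_assoc]
  simp only [mulInvariantVectorField]
  rw [e, mfderiv_comp (I' := 𝓡 d) (1 : N) (mdifferentiable_const_mul g _)
    (mdifferentiable_const_mul h _)]
  -- `h * 1` and `h` are different base points, so the two tangent spaces are compared through
  -- the model space
  have key : ∀ k, k = h → ∀ v : EuclideanSpace ℝ (Fin d),
      (mfderiv (𝓡 d) (𝓡 d) (fun x : N => g * x) h :
        EuclideanSpace ℝ (Fin d) →L[ℝ] EuclideanSpace ℝ (Fin d)) v =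
      (mfderiv (𝓡 d) (𝓡 d) (fun x : N => g * x) k :
        EuclideanSpace ℝ (Fin d) →L[ℝ] EuclideanSpace ℝ (Fin d)) v := by
    rintro _ rfl _; rfl
  exact key (h * 1) (mul_one h) _

theorem contMDiff_one_mulInvariantVectorField (X : GroupLieAlgebra (𝓡 d) N) :
    ContMDiff (𝓡 d) (𝓡 d).tangent 1
      (fun g : N => (⟨g, mulInvariantVectorField X g⟩ : TangentBundle (𝓡 d) N)) :=
  (contMDiff_mulInvariantVectorField X).of_le (by simp)

theorem IsMIntegralCurveOn.mul_left {γ : ℝ → N} {X : GroupLieAlgebra (𝓡 d) N} {s : Set ℝ}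
    (hγ : IsMIntegralCurveOn γ (mulInvariantVectorField (I := 𝓡 d) X) s) (g : N) :
    IsMIntegralCurveOn (fun t => g * γ t) (mulInvariantVectorField (I := 𝓡 d) X) s := by
  intro t ht
  have h := ((mdifferentiable_const_mul g (γ t)).hasMFDerivAt).comp_hasMFDerivWithinAt t (hγ t ht)
  refine h.congr_mfderiv (ContinuousLinearMap.ext fun a => ?_)
  exact ((mfderiv (𝓡 d) (𝓡 d) (fun x : N => g * x) (γ t)).map_smul a _).trans
    (congrArg (fun v : EuclideanSpace ℝ (Fin d) => (show ℝ from a) • v)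
      (mfderiv_mul_left_mulInvariantVectorField X g (γ t)))

variable [T2Space N]

/-- Left-invariant vector fields are complete: left translation carries a local integral curve at
the identity to one at any point, defined on an interval of the same length. -/
theorem exists_isOneParam (X : GroupLieAlgebra (𝓡 d) N) : ∃ γ, IsOneParam X γ := by
  obtain ⟨γ, h0, hγ⟩ := exists_isMIntegralCurveAt_of_contMDiffAt_boundaryless (I := 𝓡 d) 0
    (contMDiff_one_mulInvariantVectorField X (1 : N))
  obtain ⟨ε, hε, hγ⟩ := isMIntegralCurveAt_iff'.1 hγ
  rw [Real.ball_eq_Ioo, zero_sub, zero_add] at hγ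
  obtain ⟨δ, h1, h2⟩ := exists_isMIntegralCurve_of_isMIntegralCurveOn
    (contMDiff_one_mulInvariantVectorField X) hε
    (fun x => ⟨fun t => x * γ t, by simp [h0], hγ.mul_left x⟩) (1 : N)
  exact ⟨δ, h1, h2⟩

namespace IsOneParam

variable {X : GroupLieAlgebra (𝓡 d) N} {γ : ℝ → N}

theorem map_add (h : IsOneParam X γ) (s t : ℝ) : γ (s + t) = γ s * γ t := by
  have h1 : IsMIntegralCurve (fun t => γ s * γ t) (mulInvariantVectorField (I := 𝓡 d) X) := by
    rw [isMIntegralCurve_iff_isMIntegralCurveOn]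
    exact (h.isMIntegralCurve.isMIntegralCurveOn _).mul_left _
  have h2 := isMIntegralCurve_Ioo_eq_of_contMDiff_boundaryless (t₀ := 0)
    (contMDiff_one_mulInvariantVectorField X) (h.isMIntegralCurve.comp_add s) h1
    (by simp [h.zero])
  have := congrFun h2 t
  simpa [add_comm] using this

theorem lieExp_eq (h : IsOneParam X γ) : lieExp X = γ 1 := by
  have := Classical.epsilon_spec (p := fun g : N => ∃ γ : ℝ → N,
    γ 0 = 1 ∧ IsMIntegralCurve γ (mulInvariantVectorField (I := 𝓡 d) X) ∧ γ 1 = g)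
    ⟨γ 1, γ, h.zero, h.isMIntegralCurve, rfl⟩
  obtain ⟨δ, h0, hδ, h1⟩ := this
  have h2 := isMIntegralCurve_Ioo_eq_of_contMDiff_boundaryless (t₀ := 0)
    (contMDiff_one_mulInvariantVectorField X) hδ h.isMIntegralCurve (by rw [h0, h.zero])
  rw [← h2, h1]
  rfl

end IsOneParam

theorem lieExp_zero : lieExp (0 : GroupLieAlgebra (𝓡 d) N) = 1 := by
  have h : IsOneParam (0 : GroupLieAlgebra (𝓡 d) N) (fun _ : ℝ => (1 : N)) :=
    ⟨rfl, isMIntegralCurve_const (mulInvariantVectorField_one 0)⟩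
  exact h.lieExp_eq

end OneParameter

/-! ### Differentiation along one-parameter subgroups -/

theorem hasDerivAt_diag {G : ℝ × ℝ → ℂ} {s : ℝ} {p q : ℂ} (hG : DifferentiableAt ℝ G (s, s))
    (hp : HasDerivAt (fun x => G (x, s)) p s) (hq : HasDerivAt (fun y => G (s, y)) q s) :
    HasDerivAt (fun x => G (x, x)) (p + q) s := by
  have h := hG.hasFDerivAt
  have h1 := h.comp_hasDerivAt (f := fun x => (x, s)) s
    ((hasDerivAt_id s).prodMk (hasDerivAt_const s s))
  have h2 := h.comp_hasDerivAt (f := fun y => (s, y)) s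
    ((hasDerivAt_const s s).prodMk (hasDerivAt_id s))
  have h3 := h.comp_hasDerivAt (f := fun x => (x, x)) s
    ((hasDerivAt_id s).prodMk (hasDerivAt_id s))
  have e1 := hp.unique h1
  have e2 := hq.unique h2
  rw [e1, e2, ← map_add]
  rw [show ((1 : ℝ), (0 : ℝ)) + (0, 1) = (1, 1) by simp]
  exact h3

section Derivative

variable {d : ℕ} {N : Type*} [TopologicalSpace N] [ChartedSpace (EuclideanSpace ℝ (Fin d)) N]
  [Group N] [LieGroup (𝓡 d) ∞ N]

theorem MDifferentiable.mul_mul {φ : N → ℂ} (hφ : MDifferentiable (𝓡 d) 𝓘(ℝ, ℂ) φ) (a b : N) :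
    MDifferentiable (𝓡 d) 𝓘(ℝ, ℂ) (fun g => φ (a * g * b)) := by
  have h1 : ContMDiff (𝓡 d) (𝓡 d) ∞ (fun g : N => a * g * b) :=
    (contMDiff_const.mul contMDiff_id).mul contMDiff_const
  exact hφ.comp (h1.mdifferentiable (by simp))

theorem continuous_derivOne_mul_right {φ : N → ℂ} (hφ : ContMDiff (𝓡 d) 𝓘(ℝ, ℂ) ∞ φ)
    (W : GroupLieAlgebra (𝓡 d) N) : Continuous fun b : N => derivOne (fun g => φ (g * b)) W := by
  rw [continuous_iff_continuousAt]
  intro b₀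
  have h1 : ContMDiff ((𝓡 d).prod (𝓡 d)) 𝓘(ℝ, ℂ) ∞
      (Function.uncurry fun b g : N => φ (g * b)) :=
    hφ.comp (contMDiff_snd.mul contMDiff_fst)
  -- `ContMDiffAt.mfderiv_apply` provides continuity in tangent coordinates; these are trivial here,
  -- as the derivative is always taken at `1` and the target is `ℂ`
  let w : EuclideanSpace ℝ (Fin d) := W
  have hw : ContMDiffAt (𝓡 d) 𝓘(ℝ, EuclideanSpace ℝ (Fin d)) 0 (fun _ : N => w) b₀ :=
    contMDiffAt_const
  have h2 := (ContMDiffAt.mfderiv_apply (m := 0) (fun b g : N => φ (g * b)) (fun _ => 1) id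
    (fun _ => w) (x₀ := b₀) h1.contMDiffAt contMDiffAt_const contMDiffAt_id hw
    (by simp)).continuousAt
  refine h2.congr (Eventually.of_forall fun b => ?_)
  have h3 := inTangentCoordinates_eq (I := 𝓡 d) (I' := 𝓘(ℝ, ℂ)) (fun _ : N => (1 : N))
    (fun b => φ (1 * b)) (fun b => mfderiv (𝓡 d) 𝓘(ℝ, ℂ) (fun g => φ (g * b)) (1 : N))
    (x₀ := b₀) (x := b) (by simp) (mem_univ _)
  have h4 : (tangentBundleCore (𝓡 d) N).coordChange (achart (EuclideanSpace ℝ (Fin d)) (1 : N))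
    (achart (EuclideanSpace ℝ (Fin d)) (1 : N)) 1 w = w :=
      (tangentBundleCore (𝓡 d) N).coordChange_self _ _ (mem_achart_source _ _) _
  have h5 : ∀ z v, (tangentBundleCore 𝓘(ℝ, ℂ) ℂ).coordChange (achart ℂ (φ (1 * b)))
      (achart ℂ (φ (1 * b₀))) z v = v := by
    intro z v
    rw [show achart ℂ (φ (1 * b)) = achart ℂ (φ (1 * b₀)) from rfl]
    exact (tangentBundleCore 𝓘(ℝ, ℂ) ℂ).coordChange_self _ _ (mem_univ _) _
  refine (congrArg (fun A : EuclideanSpace ℝ (Fin d) →L[ℝ] ℂ => A w) h3).trans ?_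
  refine (h5 _ _).trans ?_
  exact congrArg (derivOne fun g => φ (g * b)) h4

variable [T2Space N]

/-- Duhamel's formula: along the path `s ↦ exp ((1 - s) Z) exp (s Y)` from `exp Z` to `exp Y`, a
function changes at the rate given by `Y - Z`, inserted between the two factors. -/
theorem hasDerivAt_oneParam_mul_oneParam {Y Z : GroupLieAlgebra (𝓡 d) N} {γ δ : ℝ → N}
    (hγ : IsOneParam Y γ) (hδ : IsOneParam Z δ) {φ : N → ℂ}
    (hφ : MDifferentiable (𝓡 d) 𝓘(ℝ, ℂ) φ) (s : ℝ) :
    HasDerivAt (fun s => φ (δ (1 - s) * γ s))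
      (derivOne (fun g => φ (δ (1 - s) * g * γ s)) (Y - Z)) s := by
  set D := derivOne (d := d) (fun g => φ (δ (1 - s) * g * γ s))
  have hd := hφ.mul_mul (d := d) (δ (1 - s)) (γ s)
  -- by the homomorphism property, each factor can be differentiated at parameter `0`, with the
  -- moving point inserted between `δ (1 - s)` and `γ s`
  have hp : HasDerivAt (fun x => φ (δ (1 - x) * γ s)) (-D Z) s := by
    have h0 : HasDerivAt (fun t => φ (δ (1 - s) * δ t * γ s)) (D Z) (s - s) := by
      rw [sub_self]; exact hδ.hasDerivAt_zero hd
    have h1 := h0.scomp (h := fun x => s - x) s ((hasDerivAt_id s).const_sub s)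
    simp only [neg_smul, one_smul] at h1
    refine h1.congr_of_eventuallyEq (Eventually.of_forall fun x => ?_)
    simp only [Function.comp, ← hδ.map_add]
    congr 4; ring
  have hq : HasDerivAt (fun y => φ (δ (1 - s) * γ y)) (D Y) s := by
    have h0 : HasDerivAt (fun t => φ (δ (1 - s) * γ t * γ s)) (D Y) (s - s) := by
      rw [sub_self]; exact hγ.hasDerivAt_zero hd
    have h1 := h0.scomp (h := fun x => x - s) s ((hasDerivAt_id s).sub_const s)
    simp only [one_smul] at h1
    refine h1.congr_of_eventuallyEq (Eventually.of_forall fun x => ?_)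
    simp only [Function.comp, mul_assoc, ← hγ.map_add]
    congr 3; ring
  have hG : MDifferentiable 𝓘(ℝ, ℝ × ℝ) 𝓘(ℝ, ℂ) (fun p : ℝ × ℝ => φ (δ (1 - p.1) * γ p.2)) := by
    have h1 : MDifferentiable 𝓘(ℝ, ℝ × ℝ) (𝓡 d) (fun p : ℝ × ℝ => δ (1 - p.1)) :=
      hδ.mdifferentiable.comp
        (mdifferentiable_iff_differentiable.2
          (by fun_prop : Differentiable ℝ fun p : ℝ × ℝ => 1 - p.1))
    have h2 : MDifferentiable 𝓘(ℝ, ℝ × ℝ) (𝓡 d) (fun p : ℝ × ℝ => γ p.2) :=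
      hγ.mdifferentiable.comp
        (mdifferentiable_iff_differentiable.2
          (by fun_prop : Differentiable ℝ fun p : ℝ × ℝ => p.2))
    have h3 := (contMDiff_mul (𝓡 d) ∞ (G := N)).mdifferentiable (by simp)
    exact hφ.comp (h3.comp (h1.prodMk h2))
  have := hasDerivAt_diag (hG.differentiable _) hp hq
  rwa [map_sub, sub_eq_neg_add]

end Derivative

/-! ### Dilation orbits of Gårding vectors -/

namespace LieGrading

variable {L : Type*} [LieRing L] [LieAlgebra ℝ L]

theorem exists_scale_eq_sum (𝒢 : LieGrading L) (x : L) :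
    ∃ (s : Finset ℕ) (y : ℕ → L), ∀ r, 𝒢.scale r x = ∑ k ∈ s, r ^ k • y k := by
  obtain ⟨f, rfl⟩ := 𝒢.bijective_coe.2 x
  classical
  refine ⟨f.support, fun k => f k, fun r => ?_⟩
  rw [DirectSum.coeLinearMap_eq_dfinsuppSum, DFinsupp.sum, map_sum]
  exact Finset.sum_congr rfl fun k _ => 𝒢.scale_of_mem r (f k).2

theorem scale_zero (𝒢 : LieGrading L) (x : L) : 𝒢.scale 0 x = 0 := by
  obtain ⟨f, rfl⟩ := 𝒢.bijective_coe.2 x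
  classical
  rw [DirectSum.coeLinearMap_eq_dfinsuppSum, DFinsupp.sum, map_sum]
  refine Finset.sum_eq_zero fun k _ => ?_
  rw [𝒢.scale_of_mem 0 (f k).2]
  rcases Nat.eq_zero_or_pos k with rfl | hk
  · rw [(Submodule.eq_bot_iff _).1 𝒢.zero_eq_bot _ (f 0).2, smul_zero]
  · rw [zero_pow hk.ne', zero_smul]

end LieGrading

theorem inner_map_mul {N H : Type*} [Group N] [NormedAddCommGroup H] [InnerProductSpace ℂ H]
    (T : N →* (H ≃ₗᵢ[ℂ] H)) (a b : N) (h h' : H) :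
    inner ℂ (T (a * b) h) h' = inner ℂ (T b h) (T a⁻¹ h') := by
  have e : h' = T a (T a⁻¹ h') := by
    rw [← Function.comp_apply (f := T a), ← LinearIsometryEquiv.coe_mul, ← map_mul,
      mul_inv_cancel, map_one, LinearIsometryEquiv.coe_one, id]
  conv_lhs => rw [e, map_mul, LinearIsometryEquiv.coe_mul, Function.comp_apply,
    LinearIsometryEquiv.inner_map_map]

section Garding

variable {d : ℕ} {N : Type*} [TopologicalSpace N] [ChartedSpace (EuclideanSpace ℝ (Fin d)) N]
  [Group N] [LieGroup (𝓡 d) ∞ N] [T2Space N]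
  {H : Type*} [NormedAddCommGroup H] [InnerProductSpace ℂ H]

/-- The derivatives at the identity of the matrix coefficients `a ↦ ⟨T(a) T(b) h, h'⟩` of a Gårding
vector `h` are bounded functionals of `h'`, uniformly for `b` in a compact set. This is the uniform
boundedness principle, used first for the difference quotients and then for the derivatives. -/
theorem exists_norm_derivOne_le [CompleteSpace H] {T : N →* (H ≃ₗᵢ[ℂ] H)} {h : H}
    (hh : h ∈ gardingSpace d T) {K : Set N} (hK : IsCompact K) (W : GroupLieAlgebra (𝓡 d) N) :
    ∃ C : ℝ, 0 ≤ C ∧ ∀ b ∈ K, ∀ h' : H,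
      ‖derivOne (d := d) (fun g => inner ℂ (T (g * b) h) h') W‖ ≤ C * ‖h'‖ := by
  obtain ⟨γ, hγ⟩ := exists_isOneParam W
  have hlim : ∀ b : N, Tendsto
      (fun (t : ℝ) (h' : H) => ((t⁻¹ : ℝ) : ℂ) • innerSL ℂ (T (γ t * b) h - T b h) h') (𝓝[≠] 0)
      (𝓝 fun h' => derivOne (d := d) (fun g => inner ℂ (T (g * b) h) h') W) := by
    intro b
    rw [tendsto_pi_nhds]
    intro h'
    have hφ : MDifferentiable (𝓡 d) 𝓘(ℝ, ℂ) (fun g : N => inner ℂ (T (g * b) h) h') := by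
      simpa using ((hh h').mdifferentiable (by simp)).mul_mul (d := d) 1 b
    have := (hγ.hasDerivAt_zero hφ).tendsto_slope_zero
    refine this.congr fun t => ?_
    simp [hγ.zero]
  let ℓ : K → H →L[ℂ] ℂ := fun b => continuousLinearMapOfTendsto
    (fun t : ℝ => ((t⁻¹ : ℝ) : ℂ) • innerSL ℂ (T (γ t * b) h - T b h)) (hlim b)
  obtain ⟨C, hC⟩ := banach_steinhaus (g := ℓ) fun h' => by
    obtain ⟨C, hC⟩ := hK.exists_bound_of_continuousOn
      (continuous_derivOne_mul_right (hh h') W).continuousOn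
    exact ⟨C, fun b => hC b b.2⟩
  exact ⟨|C|, abs_nonneg C, fun b hb h' =>
    (ℓ ⟨b, hb⟩).le_of_opNorm_le ((hC ⟨b, hb⟩).trans (le_abs_self C)) h'⟩

/-- The mean value inequality for Duhamel's formula, applied to the matrix coefficient of `h` and of
`T (exp Y) h - T (exp Z) h`. -/
theorem norm_map_lieExp_sub_map_lieExp_le {T : N →* (H ≃ₗᵢ[ℂ] H)} {h : H}
    (hh : h ∈ gardingSpace d T) {Y Z : GroupLieAlgebra (𝓡 d) N} {γ : ℝ → N} (hγ : IsOneParam Y γ)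
    {C : ℝ} (hC0 : 0 ≤ C) (hC : ∀ b ∈ γ '' Icc 0 1, ∀ h' : H,
      ‖derivOne (d := d) (fun g => inner ℂ (T (g * b) h) h') (Y - Z)‖ ≤ C * ‖h'‖) :
    ‖T (lieExp Y) h - T (lieExp Z) h‖ ≤ C := by
  obtain ⟨δ, hδ⟩ := exists_isOneParam Z
  set v := T (lieExp Y) h - T (lieExp Z) h with hv
  have hd := hasDerivAt_oneParam_mul_oneParam hγ hδ ((hh v).mdifferentiable (by simp))
  have hbound := norm_image_sub_le_of_norm_deriv_le_segment_01' (C := C * ‖v‖)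
    (fun s _ => (hd s).hasDerivWithinAt) fun s hs => by
      have := hC (γ s) ⟨s, Ico_subset_Icc_self hs, rfl⟩ (T (δ (1 - s))⁻¹ v)
      rw [LinearIsometryEquiv.norm_map] at this
      simpa only [mul_assoc, inner_map_mul] using this
  simp only [sub_self, sub_zero, hδ.zero, hγ.zero, one_mul, mul_one, ← hγ.lieExp_eq,
    ← hδ.lieExp_eq, ← inner_sub_left] at hbound
  rw [← hv, inner_self_eq_norm_sq_to_K] at hbound
  norm_cast at hbound
  rcases (norm_nonneg v).eq_or_lt with h0 | h0
  · rwa [← h0]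
  · rw [abs_of_nonneg (by positivity), sq] at hbound
    exact le_of_mul_le_mul_right hbound h0

/-- A Lipschitz estimate along the dilation orbits, with constants depending on the base point
`r₀`. -/
theorem exists_norm_map_lieExp_scale_sub_le [CompleteSpace H] {T : N →* (H ≃ₗᵢ[ℂ] H)} {h : H}
    (hh : h ∈ gardingSpace d T) (𝒢 : LieGrading (GroupLieAlgebra (𝓡 d) N))
    (X : GroupLieAlgebra (𝓡 d) N) (r₀ : ℝ) :
    ∃ (s : Finset ℕ) (C : ℕ → ℝ), (∀ k, 0 ≤ C k) ∧ ∀ r,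
      ‖T (lieExp (𝒢.scale r₀ X)) h - T (lieExp (𝒢.scale r X)) h‖ ≤
        ∑ k ∈ s, |r₀ ^ k - r ^ k| * C k := by
  obtain ⟨s, y, hy⟩ := 𝒢.exists_scale_eq_sum X
  obtain ⟨γ, hγ⟩ := exists_isOneParam (𝒢.scale r₀ X)
  have hK : IsCompact (γ '' Icc 0 1) := isCompact_Icc.image hγ.isMIntegralCurve.continuous
  choose C hC0 hC using fun k => exists_norm_derivOne_le hh hK (y k)
  refine ⟨s, C, hC0, fun r => norm_map_lieExp_sub_map_lieExp_le hh hγ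
    (Finset.sum_nonneg fun k _ => mul_nonneg (abs_nonneg _) (hC0 k)) fun b hb h' => ?_⟩
  rw [hy, hy, ← Finset.sum_sub_distrib, map_sum, Finset.sum_mul]
  refine (norm_sum_le _ _).trans (Finset.sum_le_sum fun k _ => ?_)
  rw [← sub_smul, map_smul, norm_smul, Real.norm_eq_abs, mul_assoc]
  exact mul_le_mul_of_nonneg_left (hC k b hb h') (abs_nonneg _)

/-- The estimate on matrix coefficients replaces the smooth dependence of `exp X` on `X`. -/
theorem continuous_map_lieExp_scale [CompleteSpace H] {T : N →* (H ≃ₗᵢ[ℂ] H)} {h : H}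
    (hh : h ∈ gardingSpace d T) (𝒢 : LieGrading (GroupLieAlgebra (𝓡 d) N))
    (X : GroupLieAlgebra (𝓡 d) N) : Continuous fun r => T (lieExp (𝒢.scale r X)) h := by
  rw [continuous_iff_continuousAt]
  intro r₀
  obtain ⟨s, C, -, hC⟩ := exists_norm_map_lieExp_scale_sub_le hh 𝒢 X r₀
  have hlim : Tendsto (fun r : ℝ => ∑ k ∈ s, |r₀ ^ k - r ^ k| * C k) (𝓝 r₀) (𝓝 0) := by
    have : Continuous fun r : ℝ => ∑ k ∈ s, |r₀ ^ k - r ^ k| * C k := by fun_prop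
    simpa using this.tendsto r₀
  rw [ContinuousAt, tendsto_iff_norm_sub_tendsto_zero]
  refine squeeze_zero (fun _ => norm_nonneg _) (fun r => ?_) hlim
  rw [norm_sub_rev]
  exact hC r

/-- The Lipschitz estimate at the base point `r₀ = 0`, where the dilation collapses to `0`: as there
is no component of degree `0`, each term is at most `r` times a constant. -/
theorem exists_norm_map_lieExp_scale_sub_self_le [CompleteSpace H] {T : N →* (H ≃ₗᵢ[ℂ] H)} {h : H}
    (hh : h ∈ gardingSpace d T) (𝒢 : LieGrading (GroupLieAlgebra (𝓡 d) N))
    (X : GroupLieAlgebra (𝓡 d) N) :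
    ∃ C : ℝ, ∀ r ∈ Icc (0 : ℝ) 1, ‖T (lieExp (𝒢.scale r X)) h - h‖ ≤ C * r := by
  obtain ⟨s, C, hC0, hC⟩ := exists_norm_map_lieExp_scale_sub_le hh 𝒢 X 0
  refine ⟨∑ k ∈ s, C k, fun r hr => ?_⟩
  have h1 := hC r
  rw [𝒢.scale_zero, lieExp_zero, map_one, LinearIsometryEquiv.coe_one, id, norm_sub_rev] at h1
  refine h1.trans ?_
  rw [Finset.sum_mul]
  refine Finset.sum_le_sum fun k _ => ?_
  rw [mul_comm]
  refine mul_le_mul_of_nonneg_left ?_ (hC0 k)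
  rcases Nat.eq_zero_or_pos k with rfl | hk
  · simpa using hr.1
  · rw [zero_pow hk.ne', zero_sub, abs_neg, abs_of_nonneg (pow_nonneg hr.1 k)]
    exact pow_le_of_le_one hr.1 hr.2 hk.ne'

end Garding

/-! ### Integrability for admissible weights -/

/-- A function that is `O(r)` near `0` and bounded is integrable for an admissible weight: the
factor `r` compensates the density `e^{-u(r)/2} r⁻¹ ≤ r⁻¹` on `(0, 1]`. -/
theorem IsAdmissibleWeight.integrable {u : ℝ → ℝ} (hu : IsAdmissibleWeight u) {f : ℝ → ℝ}
    (hf : Continuous f) {A B : ℝ} (hA : ∀ r ∈ Ioc (0 : ℝ) 1, ‖f r‖ ≤ A * r) (hB : ∀ r, ‖f r‖ ≤ B) :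
    Integrable f (halfLineMeasure u) := by
  have hsplit : (univ : Set ℝ) = Iic 1 ∪ Ioi 1 := by simp
  rw [← integrableOn_univ, hsplit]
  refine IntegrableOn.union ?_ ?_
  · set ρ : ℝ → ENNReal := fun r => ENNReal.ofReal (Real.exp (-(u r) / 2) * r⁻¹)
    have hρ : AEMeasurable ρ (volume.restrict (Ioc 0 1)) := by
      refine AEMeasurable.ennreal_ofReal (ContinuousOn.aemeasurable ?_ measurableSet_Ioc)
      have h1 : ContinuousOn u (Ioc 0 1) := hu.smooth.continuousOn.mono Ioc_subset_Ioi_self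
      exact (h1.neg.div_const 2).rexp.mul
        (continuousOn_inv₀.mono fun r hr => (mem_Ioc.1 hr).1.ne')
    have e : (halfLineMeasure u).restrict (Iic 1) =
        (volume.restrict (Ioc 0 1)).withDensity ρ := by
      rw [halfLineMeasure, restrict_withDensity measurableSet_Iic,
        Measure.restrict_restrict measurableSet_Iic, inter_comm, Ioi_inter_Iic]
    rw [IntegrableOn, e]
    refine ⟨hf.aestronglyMeasurable, ?_⟩
    rw [HasFiniteIntegral,
      lintegral_withDensity_eq_lintegral_mul₀ hρ hf.enorm.measurable.aemeasurable]
    have hle : ∫⁻ r in Ioc (0 : ℝ) 1, (ρ * fun r => ‖f r‖ₑ) r ≤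
        ∫⁻ r in Ioc (0 : ℝ) 1, ENNReal.ofReal A := by
      refine setLIntegral_mono measurable_const fun r hr => ?_
      rw [Pi.mul_apply, ← ofReal_norm, ← ENNReal.ofReal_mul (by have := hr.1; positivity)]
      refine ENNReal.ofReal_le_ofReal ?_
      have h1 : Real.exp (-(u r) / 2) ≤ 1 := Real.exp_le_one_iff.2 (by linarith [hu.pos r hr.1])
      have h2 := hA r hr
      have h3 : 0 < r⁻¹ := inv_pos.2 hr.1
      calc Real.exp (-(u r) / 2) * r⁻¹ * ‖f r‖ ≤ 1 * r⁻¹ * (A * r) := by gcongr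
        _ = A := by rw [one_mul, mul_comm A, inv_mul_cancel_left₀ hr.1.ne']
    exact hle.trans_lt (by simp)
  · exact Measure.integrableOn_of_bounded (hu.tail_lt_top 1 one_pos).ne hf.aestronglyMeasurable
      (ae_of_all _ hB)

/-! ### Almost invariance of Gårding vectors -/

section Conclusion

variable {d : ℕ} {N : Type*} [TopologicalSpace N] [ChartedSpace (EuclideanSpace ℝ (Fin d)) N]
  [Group N] [LieGroup (𝓡 d) ∞ N] [T2Space N]
  {H : Type*} [NormedAddCommGroup H] [InnerProductSpace ℂ H] [CompleteSpace H]

theorem isAlmostInvariant_of_mem_gardingSpace {T : N →* (H ≃ₗᵢ[ℂ] H)} {h : H}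
    (hh : h ∈ gardingSpace d T) (h0 : h ≠ 0) (𝒢 : LieGrading (GroupLieAlgebra (𝓡 d) N))
    {u : ℝ → ℝ} (hu : IsAdmissibleWeight u) :
    IsAlmostInvariant 𝒢.dilate T (halfLineMeasure u) h := by
  refine ⟨h0, fun a => ?_⟩
  obtain ⟨C, hC⟩ := exists_norm_map_lieExp_scale_sub_self_le hh 𝒢 (lieLog a)
  refine hu.integrable (A := C) (B := ‖h‖ + ‖h‖)
    (((continuous_map_lieExp_scale hh 𝒢 (lieLog a)).sub continuous_const).norm) (fun r hr => ?_)
    fun r => ?_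
  · rw [norm_norm]
    exact hC r (Ioc_subset_Icc_self hr)
  · rw [norm_norm]
    exact (norm_sub_le _ _).trans (by rw [LinearIsometryEquiv.norm_map])

theorem isBigO_inner_conjRep_sub_one {T : N →* (H ≃ₗᵢ[ℂ] H)} {h : H}
    (hh : h ∈ gardingSpace d T) (h1 : ‖h‖ = 1) (𝒢 : LieGrading (GroupLieAlgebra (𝓡 d) N)) (a : N) :
    (fun r : ℝ => inner ℂ (conjRep 𝒢.dilate T r a h) h - 1) =O[𝓝[>] 0] fun r : ℝ => r := by
  obtain ⟨C, hC⟩ := exists_norm_map_lieExp_scale_sub_self_le hh 𝒢 (lieLog a)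
  refine Asymptotics.IsBigO.of_bound C ?_
  filter_upwards [Ioo_mem_nhdsGT one_pos] with r hr
  have e : (1 : ℂ) = inner ℂ h h := by rw [inner_self_eq_norm_sq_to_K, h1]; simp
  rw [e, ← inner_sub_left, Real.norm_eq_abs, abs_of_pos hr.1]
  refine (norm_inner_le_norm _ _).trans ?_
  rw [h1, mul_one]
  exact hC r (Ioo_subset_Icc_self hr)

end Conclusion

/-! ### Existence of Gårding vectors -/

section ExistsGarding

variable {d : ℕ} {N : Type*} [TopologicalSpace N] [ChartedSpace (EuclideanSpace ℝ (Fin d)) N]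
  [Group N] [LieGroup (𝓡 d) ∞ N] [T2Space N]

/-- Convolving a continuous function with a smooth function supported close to the identity gives
a function that is smooth near the identity: everything takes place in the chart at the identity,
where smoothness of parametric integrals is available. -/
theorem contMDiffAt_one_integral_inv_mul [MeasurableSpace N] [BorelSpace N] (μ : Measure N)
    [IsFiniteMeasureOnCompacts μ] {k : N → ℂ} (hk : Continuous k) {φ : N → ℝ}
    (hφ : ContMDiff (𝓡 d) 𝓘(ℝ, ℝ) ∞ φ) {V K : Set N} (hV : IsOpen V) (hV1 : (1 : N) ∈ V)
    (hK : IsCompact K) (hKs : K ⊆ (extChartAt (𝓡 d) (1 : N)).source)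
    (hVK : ∀ a ∈ V, ∀ g, φ (a⁻¹ * g) ≠ 0 → g ∈ K) :
    ContMDiffAt (𝓡 d) 𝓘(ℝ, ℂ) ∞ (fun a : N => ∫ g, k g * (φ (a⁻¹ * g) : ℂ) ∂μ) 1 := by
  set e := extChartAt (𝓡 d) (1 : N) with he
  have het : IsOpen e.target := isOpen_extChartAt_target 1
  have hes : IsOpen e.source := isOpen_extChartAt_source 1
  have hec : ContinuousOn e K := (continuousOn_extChartAt 1).mono hKs
  have hsymm : ContMDiffOn 𝓘(ℝ, EuclideanSpace ℝ (Fin d)) (𝓡 d) ∞ e.symm e.target :=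
    contMDiffOn_extChartAt_symm 1
  have hKc : IsCompact (e '' K) := hK.image_of_continuousOn hec
  have hKt : e '' K ⊆ e.target := by
    rintro _ ⟨x, hx, rfl⟩
    exact e.map_source (hKs hx)
  have hmem : ∀ y ∈ e.target, e.symm y ∈ K → y ∈ e '' K := fun y hy hyK =>
    ⟨e.symm y, hyK, e.right_inv hy⟩
  set s : Set (EuclideanSpace ℝ (Fin d)) := e.target ∩ e.symm ⁻¹' V
  have hs : IsOpen s := hsymm.continuousOn.isOpen_inter_preimage het hV
  classical
  -- the kernel `φ (a⁻¹ * g)` in the chart, extended by zero; the sign of `y` is reversed because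
  -- the integral is going to be a convolution evaluated at `0`
  let ψ : EuclideanSpace ℝ (Fin d) → EuclideanSpace ℝ (Fin d) → ℂ := fun p y =>
    if -y ∈ e.target then (φ ((e.symm p)⁻¹ * e.symm (-y)) : ℂ) else 0
  have hψ0 : ∀ p y, p ∈ s → y ∉ -(e '' K) → ψ p y = 0 := by
    intro p y hp hy
    by_cases ht : -y ∈ e.target
    · simp only [ψ, if_pos ht]
      by_contra hne
      exact hy (hmem _ ht (hVK _ hp.2 _ (by simpa using hne)))
    · simp only [ψ, if_neg ht]
  -- where the formula defining `ψ` is not available, `ψ` vanishes locally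
  have hψ : ContDiffOn ℝ ∞ (Function.uncurry ψ) (s ×ˢ univ) := by
    rintro ⟨p, y⟩ ⟨hp, -⟩
    refine ContDiffAt.contDiffWithinAt ?_
    have hp' : s ∈ 𝓝 p := hs.mem_nhds hp
    by_cases ht : -y ∈ e.target
    · have hsm : ContMDiffAt (𝓘(ℝ, EuclideanSpace ℝ (Fin d) × EuclideanSpace ℝ (Fin d)))
          𝓘(ℝ, ℂ) ∞ (fun q : EuclideanSpace ℝ (Fin d) × EuclideanSpace ℝ (Fin d) =>
            (φ ((e.symm q.1)⁻¹ * e.symm (-q.2)) : ℂ)) (p, y) := by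
        have h1 : ContMDiffAt (𝓘(ℝ, EuclideanSpace ℝ (Fin d) × EuclideanSpace ℝ (Fin d)))
            (𝓡 d) ∞ (fun q : EuclideanSpace ℝ (Fin d) × EuclideanSpace ℝ (Fin d) => e.symm q.1)
            (p, y) :=
          ContMDiffAt.comp (p, y) (hsymm.contMDiffAt (het.mem_nhds hp.1))
            (contDiff_fst.contMDiff.contMDiffAt)
        have h2 : ContMDiffAt (𝓘(ℝ, EuclideanSpace ℝ (Fin d) × EuclideanSpace ℝ (Fin d)))
            (𝓡 d) ∞ (fun q : EuclideanSpace ℝ (Fin d) × EuclideanSpace ℝ (Fin d) =>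
              e.symm (-q.2)) (p, y) :=
          ContMDiffAt.comp (g := e.symm) (p, y) (hsymm.contMDiffAt (het.mem_nhds ht))
            (contDiff_snd.neg.contMDiff.contMDiffAt)
        have h3 : ContMDiffAt 𝓘(ℝ, ℝ) 𝓘(ℝ, ℂ) ∞ (fun t : ℝ => (t : ℂ))
          (φ ((e.symm p)⁻¹ * e.symm (-y))) :=
            Complex.ofRealCLM.contDiff.contMDiff.contMDiffAt
        exact ContMDiffAt.comp (p, y) h3 (hφ.contMDiffAt.comp (p, y) (h1.inv.mul h2))
      refine hsm.contDiffAt.congr_of_eventuallyEq ?_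
      have : ∀ᶠ q : EuclideanSpace ℝ (Fin d) × EuclideanSpace ℝ (Fin d) in 𝓝 (p, y),
          -q.2 ∈ e.target :=
        (continuous_snd.neg).continuousAt.eventually (het.mem_nhds ht)
      filter_upwards [this] with q hq
      simp [Function.uncurry, ψ, hq]
    · have hy : y ∉ -(e '' K) := fun h => ht (hKt h)
      have h0 : ∀ᶠ q : EuclideanSpace ℝ (Fin d) × EuclideanSpace ℝ (Fin d) in 𝓝 (p, y),
          Function.uncurry ψ q = 0 := by
        filter_upwards [prod_mem_nhds hp' (hKc.neg.isClosed.isOpen_compl.mem_nhds hy)] with q hq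
        exact hψ0 _ _ hq.1 hq.2
      exact contDiffAt_const.congr_of_eventuallyEq h0
  -- the measure and the function `k` in the chart
  have hem : AEMeasurable e (μ.restrict K) := hec.aemeasurable hK.measurableSet
  have : IsFiniteMeasure (μ.restrict K) := ⟨by simpa using hK.measure_lt_top⟩
  set ν : Measure (EuclideanSpace ℝ (Fin d)) := (μ.restrict K).map e with hν
  set f : EuclideanSpace ℝ (Fin d) → ℂ := (e '' K).indicator (k ∘ e.symm) with hf
  have hfi : Integrable f ν := by
    rw [hf, integrable_indicator_iff hKc.measurableSet]
    exact (hk.comp_continuousOn (hsymm.continuousOn.mono hKt)).integrableOn_compact hKc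
  have hconv := contDiffOn_convolution_right_with_param (n := ⊤) (ContinuousLinearMap.mul ℝ ℂ) hs
    hKc.neg hψ0 hfi.locallyIntegrable hψ
  have h1s : e 1 ∈ s := ⟨mem_extChartAt_target 1, by simpa [he] using hV1⟩
  have hF : ContDiffAt ℝ ∞ (fun p => convolution f (ψ p) (ContinuousLinearMap.mul ℝ ℂ) ν 0)
      (e 1) :=
    ContDiffAt.comp (f := fun p => (p, 0)) (e 1)
      (hconv.contDiffAt ((hs.prod isOpen_univ).mem_nhds ⟨h1s, mem_univ 0⟩))
      (contDiffAt_id.prodMk contDiffAt_const)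
  have hF' := hF.contMDiffAt.comp (1 : N) (contMDiffAt_extChartAt (I := 𝓡 d) (n := ∞))
  refine hF'.congr_of_eventuallyEq ?_
  filter_upwards [hV.mem_nhds hV1, hes.mem_nhds (mem_extChartAt_source 1)] with a haV has
  have has' : e a ∈ s := ⟨e.map_source has, by simpa [e.left_inv has] using haV⟩
  have hψa : Continuous (ψ (e a)) := by
    rw [← continuousOn_univ]
    exact hψ.continuousOn.comp (f := fun y => (e a, y)) (by fun_prop) fun y _ => ⟨has', mem_univ _⟩
  symm
  simp only [Function.comp_apply, convolution, ContinuousLinearMap.mul_apply', zero_sub]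
  have hmap : ∫ t, f t * ψ (e a) (-t) ∂ν = ∫ g in K, f (e g) * ψ (e a) (-(e g)) ∂μ :=
    integral_map hem (hfi.aestronglyMeasurable.mul
      (hψa.comp continuous_neg).aestronglyMeasurable)
  rw [hmap]
  refine Eq.trans ?_ (setIntegral_eq_integral_of_forall_compl_eq_zero (s := K) ?_)
  · refine setIntegral_congr_fun hK.measurableSet fun g hg => ?_
    simp only [hf, ψ, neg_neg, indicator_of_mem (mem_image_of_mem e hg), Function.comp_apply,
      e.left_inv (hKs hg), e.left_inv has, if_pos (e.map_source (hKs hg))]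
  · intro g hg
    have : φ (a⁻¹ * g) = 0 := by_contra fun h => hg (hVK a haV g h)
    simp [this]

end ExistsGarding

section MatrixCoefficients

variable {d : ℕ} {N : Type*} [TopologicalSpace N] [ChartedSpace (EuclideanSpace ℝ (Fin d)) N]
  [Group N] {H : Type*} [NormedAddCommGroup H] [InnerProductSpace ℂ H]

/-- It suffices to check smoothness of the matrix coefficients at the identity. -/
theorem mem_gardingSpace_of_contMDiffAt_one [LieGroup (𝓡 d) ∞ N] {T : N →* (H ≃ₗᵢ[ℂ] H)} {h : H}
    (hh : ∀ h' : H, ContMDiffAt (𝓡 d) 𝓘(ℝ, ℂ) ∞ (fun a : N => inner ℂ (T a h) h') 1) :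
    h ∈ gardingSpace d T := by
  intro h' a₀
  have h1 : ContMDiffAt (𝓡 d) (𝓡 d) ∞ (fun a : N => a₀⁻¹ * a) a₀ :=
    contMDiff_mul_left.contMDiffAt
  have h2 := ContMDiffAt.comp_of_eq (hh (T a₀⁻¹ h')) h1 (inv_mul_cancel a₀)
  refine h2.congr_of_eventuallyEq (Eventually.of_forall fun a => ?_)
  simp only [Function.comp_apply]
  rw [← inner_map_mul, mul_inv_cancel_left]

variable [LieGroup (𝓡 d) ∞ N] [T2Space N] [CompleteSpace H]

/-- Gårding's theorem, in the weak form that there are nonzero Gårding vectors: for a bump function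
`φ` supported where `Re ⟨h, T(g) h⟩ > 0`, the vector `∫ φ(g) T(g) h dg` is smooth, and its inner
product with `h` has positive real part. -/
theorem exists_mem_gardingSpace_ne_zero [Nontrivial H] (T : N →* (H ≃ₗᵢ[ℂ] H))
    (hT : ∀ h : H, Continuous fun a : N => T a h) : ∃ h ∈ gardingSpace d T, h ≠ 0 := by
  have : IsTopologicalGroup N := topologicalGroup_of_lieGroup (𝓡 d) ∞
  have : LocallyCompactSpace N := Manifold.locallyCompact_of_finiteDimensional (𝓡 d)
  borelize N
  obtain ⟨h, hh⟩ := exists_ne (0 : H)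
  have hc : Continuous fun g : N => (inner ℂ h (T g h)).re :=
    Complex.continuous_re.comp (continuous_const.inner (hT h))
  have h1pos : 0 < (inner ℂ h (T 1 h)).re := by
    rw [map_one, LinearIsometryEquiv.coe_one, id]
    change 0 < RCLike.re (inner ℂ h h)
    rw [inner_self_eq_norm_sq (𝕜 := ℂ)]
    exact pow_pos (norm_pos_iff.2 hh) 2
  obtain ⟨K, hK, hKs⟩ := exists_compact_subset (isOpen_extChartAt_source (I := 𝓡 d) (1 : N))
    (mem_extChartAt_source 1)
  obtain ⟨V, hV, hV1, hVK⟩ := exists_open_nhds_one_mul_subset (mem_interior_iff_mem_nhds.1 hKs.1)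
  obtain ⟨φ, -, hφ⟩ := (SmoothBumpFunction.nhds_basis_tsupport (I := 𝓡 d) (1 : N)).mem_iff.1
    (inter_mem (hV.mem_nhds hV1) (hc.continuousAt.eventually (lt_mem_nhds h1pos)))
  have hφ' : ∀ g, φ g ≠ 0 → g ∈ V ∧ 0 < (inner ℂ h (T g h)).re := fun g hg =>
    hφ (subset_tsupport _ hg)
  set μ : Measure N := Measure.haar
  have hint : Integrable (fun g => (φ g : ℂ) • T g h) μ := by
    refine Continuous.integrable_of_hasCompactSupport ?_ ?_
    · exact (Complex.continuous_ofReal.comp φ.continuous).smul (hT h)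
    · exact (φ.hasCompactSupport.comp_left (g := fun t : ℝ => (t : ℂ))
        Complex.ofReal_zero).smul_right
  refine ⟨∫ g, (φ g : ℂ) • T g h ∂μ, mem_gardingSpace_of_contMDiffAt_one fun h' => ?_, fun h0 => ?_⟩
  · have hsm := contMDiffAt_one_integral_inv_mul (d := d) μ (k := fun g => inner ℂ h' (T g h))
      (continuous_const.inner (hT h)) φ.contMDiff hV hV1 hK hKs.2 fun a ha g hg => hVK (by
        simpa using mul_mem_mul ha (hφ' _ hg).1)
    have hconj : ContMDiff 𝓘(ℝ, ℂ) 𝓘(ℝ, ℂ) ∞ (starRingEnd ℂ) :=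
      Complex.conjCLE.contDiff.contMDiff
    refine (hconj.contMDiffAt.comp (1 : N) hsm).congr_of_eventuallyEq
      (Eventually.of_forall fun a => ?_)
    simp only [Function.comp_apply]
    have e1 : inner ℂ (T a (∫ g, (φ g : ℂ) • T g h ∂μ)) h' =
        inner ℂ (∫ g, (φ g : ℂ) • T g h ∂μ) (T a⁻¹ h') := by
      simpa using inner_map_mul T a 1 _ h'
    rw [e1, ← inner_conj_symm, ← integral_inner hint,
      ← integral_mul_left_eq_self (fun g => inner ℂ h' (T g h) * (φ (a⁻¹ * g) : ℂ)) a]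
    congr 1
    refine integral_congr_ae (Eventually.of_forall fun g => ?_)
    simp only [inv_mul_cancel_left, inner_smul_right]
    rw [mul_comm, ← inner_conj_symm, ← inner_map_mul, inner_conj_symm]
  · have hre : ∫ g, φ g * (inner ℂ h (T g h)).re ∂μ = 0 := by
      have e := integral_inner (𝕜 := ℂ) hint h
      rw [h0, inner_zero_right] at e
      have e2 := integral_re (𝕜 := ℂ) (hint.const_inner h)
      rw [e, map_zero] at e2
      rw [← e2]
      refine integral_congr_ae (Eventually.of_forall fun g => ?_)
      beta_reduce
      rw [inner_smul_right]
      exact (Complex.re_ofReal_mul _ _).symm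
    have hpos : 0 < ∫ g, φ g * (inner ℂ h (T g h)).re ∂μ := by
      refine Continuous.integral_pos_of_hasCompactSupport_nonneg_nonzero (x := 1)
        (φ.continuous.mul hc) φ.hasCompactSupport.mul_right (fun g => ?_) ?_
      · by_cases hg : φ g = 0
        · simp [hg]
        · exact mul_nonneg φ.nonneg (hφ' g hg).2.le
      · rw [φ.eq_one, one_mul]
        exact h1pos.ne'
    exact hpos.ne' hre

end MatrixCoefficients

end

theorem mainTheorem1
    -- a connected, simply connected, nilpotent Lie group with a fixed grading of its Lie algebra
    {d : ℕ} {N : Type*} [TopologicalSpace N] [T2Space N]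
    [ChartedSpace (EuclideanSpace ℝ (Fin d)) N] [Group N] [LieGroup (𝓡 d) ∞ N]
    [ConnectedSpace N] [SimplyConnectedSpace N]
    [LieRing.IsNilpotent (GroupLieAlgebra (𝓡 d) N)]
    (𝒢 : LieGrading (GroupLieAlgebra (𝓡 d) N))
    -- a (strongly continuous) unitary representation in a nonzero Hilbert space
    {H : Type*} [NormedAddCommGroup H] [InnerProductSpace ℂ H] [CompleteSpace H] [Nontrivial H]
    (T : N →* (H ≃ₗᵢ[ℂ] H)) (hT : ∀ h : H, Continuous fun a : N => T a h)
    (hinv : HasNoInvariantVectors T)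
    -- the measure `dm(r) = e^{-u(r)/2} r⁻¹ dr` on the half-line
    (u : ℝ → ℝ) (hu : IsAdmissibleWeight u) :
    (∀ h ∈ gardingSpace d T, h ≠ 0 → IsAlmostInvariant 𝒢.dilate T (halfLineMeasure u) h) ∧
    IsSummable 𝒢.dilate T (halfLineMeasure u) ∧
    (∀ h ∈ gardingSpace d T, ‖h‖ = 1 → ∀ a : N,
      (fun r : ℝ => inner ℂ (conjRep 𝒢.dilate T r a h) h - 1) =O[𝓝[>] 0] fun r : ℝ => r) := by
  obtain ⟨h, hh, h0⟩ := exists_mem_gardingSpace_ne_zero (d := d) T hT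
  exact ⟨fun h hh h0 => isAlmostInvariant_of_mem_gardingSpace hh h0 𝒢 hu,
    ⟨hinv, h, isAlmostInvariant_of_mem_gardingSpace hh h0 𝒢 hu⟩,
    fun h hh h1 a => isBigO_inner_conjRep_sub_one hh h1 𝒢 a⟩
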